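/- Let $(W,W^{\perp})$ be a pair of independent standard Brownian motions of dimensions $d_W\ge 1$ and $d_{W^\perp}\ge 0$ on a probability space $(\Omega,\mathcal F,\mathbb P)$, and let $\mathbb F=(\mathcal F_t)_{t\ge0}$ be the filtration they generate, augmented by the $\mathbb P$-null events. Consider a market with zero interest rate and $n\ge1$ stocks $$\frac{dS^i_t}{S^i_t}=\mu^i_t\,dt+\sum_{j=1}^{d_W}\sigma^{ji}_t\,dW^j_t ,$$ where $\mu$ and $\sigma$ are continuous and $\mathbb F$-adapted and, for every $T>0$, $\sup_{t\le T}\|\lambda_t\|$ is almost surely bounded by a constant, where $\lambda_t=(\sigma_t^{-1})^{\top}\mu_t$ and $\sigma_t^{-1}$ is the Moore–Penrose inverse. For an $\mathbb F$-progressively measurable $\mathbb R^n$-valued portfolio $\pi$ (fractions of wealth) and initial wealth $x>0$, the wealth process $X^\pi$ solves $$dX^\pi_t=X^\pi_t(\sigma_t\pi_t)^\top\lambda_t\,dt+X^\pi_t(\sigma_t\pi_t)^\top dW_t,\qquad X^\pi_0=x .$$ The portfolio is admissible, $\pi\in\mathcal A$, if almost surely, for all $t\ge 0$, $X^\pi_t\ge0$,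 $\int_0^t|X^\pi_s\pi_s^\top\mu_s|\,ds<\infty$ and $\int_0^t|X^\pi_s\sigma_s\pi_s|^2ds<\infty$. An $\mathbb F$-progressively measurable random field $U:[0,\infty)\times(0,\infty)\to\mathbb R$ (with $U_t(0):=\lim_{x\downarrow0}U_t(x)$) is a forward performance process (FPP) if (a) almost surely, for all $t\ge 0$, $x\mapsto U_t(x)$ is strictly concave and strictly increasing on $(0,\infty)$; (b) for all $x>0$ and $\pi\in\mathcal A$, $(U_t(X^\pi_t))_{t\ge0}$ is an $\mathbb F$-supermartingale; (c) for all $x>0$ there is $\pi^*\in\mathcal A$ such that $(U_t(X^{\pi^*}_t))_{t\ge0}$ is an $\mathbb F$-martingale. **Lemma.** Let $A,D,p,q$ be continuous $\mathbb F$-adapted processes such that almost surely $0<p_t<q_t<1$ for all $t\ge0$, and such that for every $t>0$ almost surely $A_t>0$ and $D_t>0$. Suppose that for all $T>0$ $$\sup_{t\in[0,T]}\mathbb E[A_t]<\infty,\qquad \sup_{t\in[0,T]}\mathbb E[D_t]<\infty$$ (where $A_t$, $D_t$ are integrable for every $t\ge 0$), and that $U_t(x)=A_tx^{p_t}+D_tx^{q_t}$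 is an FPP. Then almost surely $t\mapsto p_t$ is non-decreasing and $t\mapsto q_t$ is non-increasing on $[0,\infty)$; that is, almost surely, for all $0<s<t$, $$p_0\le p_s\le p_t<q_t\le q_s\le q_0 .$$ -/

import Mathlib

open MeasureTheory ProbabilityTheory Filter Topology Set
open scoped NNReal ENNReal Matrix

namespace ForwardPerformance

/-! ### The Moore-Penrose inverse of a real matrix -/

/-- The four Penrose equations: `B` is the Moore-Penrose inverse of `A`. -/
structure IsMoorePenrose {m n : ℕ} (A : Matrix (Fin m) (Fin n) ℝ)
    (B : Matrix (Fin n) (Fin m) ℝ) : Prop where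
  mul_mul_self : A * B * A = A
  self_mul_mul : B * A * B = B
  symm_left : (A * B)ᵀ = A * B
  symm_right : (B * A)ᵀ = B * A

theorem IsMoorePenrose.unique {m n : ℕ} {A : Matrix (Fin m) (Fin n) ℝ}
    {B C : Matrix (Fin n) (Fin m) ℝ} (hB : IsMoorePenrose A B) (hC : IsMoorePenrose A C) :
    B = C := by
  have h1 : A * B = A * C := by
    calc A * B = (A * B)ᵀ := hB.symm_left.symm
      _ = (A * C * A * B)ᵀ := by rw [hC.mul_mul_self]
      _ = (A * B)ᵀ * (A * C)ᵀ := by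
          rw [← Matrix.transpose_mul, Matrix.mul_assoc (A * C) A B]
      _ = A * B * A * C := by rw [hB.symm_left, hC.symm_left, Matrix.mul_assoc (A * B) A C]
      _ = A * C := by rw [hB.mul_mul_self]
  have h2 : B * A = C * A := by
    calc B * A = (B * A)ᵀ := hB.symm_right.symm
      _ = (B * (A * C * A))ᵀ := by rw [hC.mul_mul_self]
      _ = (C * A)ᵀ * (B * A)ᵀ := by
          rw [← Matrix.transpose_mul]; simp only [Matrix.mul_assoc]
      _ = C * (A * B * A) := by
          rw [hB.symm_right, hC.symm_right]; simp only [Matrix.mul_assoc]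
      _ = C * A := by rw [hB.mul_mul_self]
  calc B = B * A * B := hB.self_mul_mul.symm
    _ = C * (A * B) := by rw [h2, Matrix.mul_assoc]
    _ = C * A * C := by rw [h1, Matrix.mul_assoc]
    _ = C := hC.self_mul_mul

theorem exists_symm_pinv {n : ℕ} {G : Matrix (Fin n) (Fin n) ℝ} (hG : G.IsHermitian) :
    ∃ H : Matrix (Fin n) (Fin n) ℝ, Hᵀ = H ∧ G * H = H * G ∧ G * H * G = G ∧ H * G * H = H := by
  classical
  obtain ⟨φ, e, hs⟩ : ∃ (φ : Matrix (Fin n) (Fin n) ℝ ≃⋆ₐ[ℝ] Matrix (Fin n) (Fin n) ℝ)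
      (e : Fin n → ℝ), G = φ (Matrix.diagonal e) :=
    ⟨Unitary.conjStarAlgAut ℝ (Matrix (Fin n) (Fin n) ℝ) hG.eigenvectorUnitary, hG.eigenvalues,
      by simpa [Function.comp_def] using hG.spectral_theorem⟩
  have hd : ∀ v : Fin n → ℝ, star (Matrix.diagonal v) = Matrix.diagonal v := by
    intro v; simp [Matrix.star_eq_conjTranspose]
  subst hs
  refine ⟨φ (Matrix.diagonal fun i => (e i)⁻¹), ?_, ?_, ?_, ?_⟩
  · have := map_star φ (Matrix.diagonal fun i => (e i)⁻¹)
    rw [hd, Matrix.star_eq_conjTranspose, Matrix.conjTranspose_eq_transpose_of_trivial] at this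
    exact this.symm
  · simp only [← map_mul, Matrix.diagonal_mul_diagonal, mul_comm]
  · simp only [← map_mul, Matrix.diagonal_mul_diagonal, mul_inv_mul_cancel]
  · simp only [← map_mul, Matrix.diagonal_mul_diagonal]
    congr 2
    funext i
    simpa using mul_inv_mul_cancel (e i)⁻¹

theorem exists_isMoorePenrose {m n : ℕ} (A : Matrix (Fin m) (Fin n) ℝ) :
    ∃ B, IsMoorePenrose A B := by
  have hG : (Aᵀ * A).IsHermitian := by
    simp [Matrix.IsHermitian, Matrix.conjTranspose_eq_transpose_of_trivial]
  obtain ⟨H, hsymm, hcomm, h1, h2⟩ := exists_symm_pinv hG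
  have key : A * (H * (Aᵀ * A)) = A := by
    have h0 : (A * (H * (Aᵀ * A)) - A)ᵀ * (A * (H * (Aᵀ * A)) - A) = 0 := by
      have e : A * (H * (Aᵀ * A)) - A = A * (H * (Aᵀ * A) - 1) := by
        rw [Matrix.mul_sub, Matrix.mul_one]
      have e2 : Aᵀ * (A * (H * (Aᵀ * A) - 1)) = 0 := by
        rw [← Matrix.mul_assoc, Matrix.mul_sub, Matrix.mul_one, ← Matrix.mul_assoc, h1, sub_self]
      rw [e, Matrix.transpose_mul, Matrix.mul_assoc, e2, Matrix.mul_zero]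
    rw [← Matrix.conjTranspose_eq_transpose_of_trivial,
      Matrix.conjTranspose_mul_self_eq_zero] at h0
    exact sub_eq_zero.mp h0
  refine ⟨H * Aᵀ, ?_, ?_, ?_, ?_⟩
  · simpa only [Matrix.mul_assoc] using key
  · calc H * Aᵀ * A * (H * Aᵀ) = H * (Aᵀ * A) * H * Aᵀ := by simp only [Matrix.mul_assoc]
      _ = H * Aᵀ := by rw [h2]
  · simp [Matrix.transpose_mul, hsymm, Matrix.mul_assoc]
  · have e : H * Aᵀ * A = H * (Aᵀ * A) := by rw [Matrix.mul_assoc]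
    rw [e, Matrix.transpose_mul, hsymm, Matrix.transpose_mul, Matrix.transpose_transpose, hcomm]

/-- The Moore-Penrose inverse of a real matrix. -/
noncomputable def pinv {m n : ℕ} (A : Matrix (Fin m) (Fin n) ℝ) : Matrix (Fin n) (Fin m) ℝ :=
  (exists_isMoorePenrose A).choose

theorem pinv_spec {m n : ℕ} (A : Matrix (Fin m) (Fin n) ℝ) : IsMoorePenrose A (pinv A) :=
  (exists_isMoorePenrose A).choose_spec

/-! ### The Brownian filtration -/

/-- The scalar components of a pair of vector-valued processes `(W, W')`. -/
def pairComponent {Ω : Type*} {d d' : ℕ} (W : ℝ≥0 → Ω → EuclideanSpace ℝ (Fin d))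
    (W' : ℝ≥0 → Ω → EuclideanSpace ℝ (Fin d')) : Fin d ⊕ Fin d' → ℝ≥0 → Ω → ℝ :=
  Sum.elim (fun i t ω => W t ω i) (fun j t ω => W' t ω j)

/-- `(W, W')` is a pair of (independent) standard Brownian motions of dimensions `d` and `d'`:
all `d + d'` scalar components are real standard Brownian motions, and they are mutually
independent as processes. -/
structure IsStandardBrownianPair {Ω : Type*} [MeasurableSpace Ω] (P : Measure Ω) {d d' : ℕ}
    (W : ℝ≥0 → Ω → EuclideanSpace ℝ (Fin d))
    (W' : ℝ≥0 → Ω → EuclideanSpace ℝ (Fin d')) : Prop where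
  brownian : ∀ k, IsBrownianReal (pairComponent W W' k) P
  indep : iIndepFun (fun k ω t => pairComponent W W' k t ω) P

/-- The sigma-algebra generated by the `P`-null events of `Ω`. -/
@[reducible] def nullSigma {Ω : Type*} [MeasurableSpace Ω] (P : Measure Ω) : MeasurableSpace Ω :=
  MeasurableSpace.generateFrom {N | MeasurableSet N ∧ P N = 0}

theorem nullSigma_le {Ω : Type*} [mΩ : MeasurableSpace Ω] (P : Measure Ω) :
    nullSigma P ≤ mΩ :=
  MeasurableSpace.generateFrom_le fun _ hN => hN.1

/-- The filtration generated by the pair of processes `(W, W')`, augmented by the null events. -/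
noncomputable def pairFiltration {Ω : Type*} [mΩ : MeasurableSpace Ω] (P : Measure Ω) {d d' : ℕ}
    (W : ℝ≥0 → Ω → EuclideanSpace ℝ (Fin d)) (W' : ℝ≥0 → Ω → EuclideanSpace ℝ (Fin d'))
    (hW : ∀ t, StronglyMeasurable (W t)) (hW' : ∀ t, StronglyMeasurable (W' t)) :
    Filtration ℝ≥0 mΩ :=
  Filtration.natural W hW ⊔ Filtration.natural W' hW' ⊔
    Filtration.const ℝ≥0 (nullSigma P) (nullSigma_le P)

/-! ### The Itô integral -/

/-- A simple predictable integrand `∑ k < N, val k * 𝟙_(time k, time (k + 1)]`, with bounded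
coefficients, `val k` being measurable with respect to the information at `time k`. -/
structure SimpleIntegrand {Ω : Type*} {mΩ : MeasurableSpace Ω} (F : Filtration ℝ≥0 mΩ)
    (d : ℕ) where
  N : ℕ
  time : ℕ → ℝ≥0
  mono : Monotone time
  val : ℕ → Ω → EuclideanSpace ℝ (Fin d)
  meas : ∀ k, StronglyMeasurable[F (time k)] (val k)
  bdd : ∃ C : ℝ, ∀ k ω, ‖val k ω‖ ≤ C

/-- The process given by a simple integrand. -/
noncomputable def SimpleIntegrand.process {Ω : Type*} {mΩ : MeasurableSpace Ω}
    {F : Filtration ℝ≥0 mΩ} {d : ℕ} (S : SimpleIntegrand F d) (t : ℝ≥0) (ω : Ω) :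
    EuclideanSpace ℝ (Fin d) :=
  ∑ k ∈ Finset.range S.N, (Ioc (S.time k) (S.time (k + 1))).indicator (fun _ => S.val k ω) t

/-- The elementary stochastic integral of a simple integrand with respect to `W`. -/
noncomputable def SimpleIntegrand.integral {Ω : Type*} {mΩ : MeasurableSpace Ω}
    {F : Filtration ℝ≥0 mΩ} {d : ℕ} (S : SimpleIntegrand F d)
    (W : ℝ≥0 → Ω → EuclideanSpace ℝ (Fin d)) (t : ℝ≥0) (ω : Ω) : ℝ :=
  ∑ k ∈ Finset.range S.N,
    inner ℝ (S.val k ω) (W (min (S.time (k + 1)) t) ω - W (min (S.time k) t) ω)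

/-- `I` is (a version of) the Itô integral process `∫₀^· Hₛ · dWₛ`: it is adapted, has almost surely
continuous paths, and is, for some sequence of simple integrands converging to `H` in
`L²([0, T])` in probability for every `T`, the limit of the elementary stochastic integrals
uniformly on `[0, T]` in probability for every `T`. -/
def IsItoIntegral {Ω : Type*} {mΩ : MeasurableSpace Ω} (P : Measure Ω) (F : Filtration ℝ≥0 mΩ)
    {d : ℕ} (W H : ℝ≥0 → Ω → EuclideanSpace ℝ (Fin d)) (I : ℝ≥0 → Ω → ℝ) : Prop :=
  StronglyAdapted F I ∧ (∀ᵐ ω ∂P, Continuous fun t => I t ω) ∧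
    ∃ S : ℕ → SimpleIntegrand F d, ∀ T : ℝ≥0, ∀ ε : ℝ≥0∞, 0 < ε →
      Tendsto (fun k => P {ω | ε ≤ ∫⁻ s in Icc (0 : ℝ) T,
        ‖(S k).process s.toNNReal ω - H s.toNNReal ω‖ₑ ^ 2}) atTop (𝓝 0) ∧
      Tendsto (fun k => P {ω | ε ≤ ⨆ t ∈ Icc (0 : ℝ≥0) T,
        ‖(S k).integral W t ω - I t ω‖ₑ}) atTop (𝓝 0)

/-! ### The market -/

/-- The Sharpe ratio `λ = (σ⁻¹)ᵀ μ`, with `σ⁻¹` the Moore-Penrose inverse. -/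
noncomputable def sharpeRatio {n d : ℕ} (μ : EuclideanSpace ℝ (Fin n))
    (σ : Matrix (Fin d) (Fin n) ℝ) : EuclideanSpace ℝ (Fin d) :=
  WithLp.toLp 2 ((pinv σ)ᵀ *ᵥ μ.ofLp)

/-- A market with `n` stocks `dSⁱ / Sⁱ = μⁱ dt + ∑ j, σ^{ji} dWʲ`: the coefficients are continuous
and adapted to the filtration of the pair of standard Brownian motions `(W, W')`, and the Sharpe
ratio is almost surely bounded on bounded time intervals. The row index of `σ` is the index of the
driving Brownian motion, the column index that of the stock. -/
structure Market (Ω : Type*) [MeasurableSpace Ω] (P : Measure Ω) (n d d' : ℕ) where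
  W : ℝ≥0 → Ω → EuclideanSpace ℝ (Fin d)
  W' : ℝ≥0 → Ω → EuclideanSpace ℝ (Fin d')
  measurable_W : ∀ t, StronglyMeasurable (W t)
  measurable_W' : ∀ t, StronglyMeasurable (W' t)
  brownian : IsStandardBrownianPair P W W'
  μ : ℝ≥0 → Ω → EuclideanSpace ℝ (Fin n)
  σ : ℝ≥0 → Ω → Matrix (Fin d) (Fin n) ℝ
  adapted_μ : StronglyAdapted (pairFiltration P W W' measurable_W measurable_W') μ
  adapted_σ : StronglyAdapted (pairFiltration P W W' measurable_W measurable_W') σ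
  continuous_μ : ∀ᵐ ω ∂P, Continuous fun t => μ t ω
  continuous_σ : ∀ᵐ ω ∂P, Continuous fun t => σ t ω
  bounded_sharpe : ∀ T : ℝ≥0, ∃ C : ℝ, ∀ᵐ ω ∂P, ∀ t ≤ T, ‖sharpeRatio (μ t ω) (σ t ω)‖ ≤ C

namespace Market

variable {Ω : Type*} [mΩ : MeasurableSpace Ω] {P : Measure Ω} {n d d' : ℕ}

/-- The information flow of the market. -/
noncomputable def filtration (M : Market Ω P n d d') : Filtration ℝ≥0 mΩ :=
  pairFiltration P M.W M.W' M.measurable_W M.measurable_W'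

/-- The process `λ`. -/
noncomputable def sharpe (M : Market Ω P n d d') (t : ℝ≥0) (ω : Ω) : EuclideanSpace ℝ (Fin d) :=
  sharpeRatio (M.μ t ω) (M.σ t ω)

/-- The process `σ π`. -/
noncomputable def exposure (M : Market Ω P n d d') (π : ℝ≥0 → Ω → EuclideanSpace ℝ (Fin n))
    (t : ℝ≥0) (ω : Ω) : EuclideanSpace ℝ (Fin d) :=
  WithLp.toLp 2 (M.σ t ω *ᵥ (π t ω).ofLp)

/-- `X` is a wealth process of the portfolio `π` (fractions of current wealth held in the stocks)
from initial wealth `x`: `dX = X (σ π)ᵀ λ dt + X (σ π)ᵀ dW`, `X₀ = x`. -/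
def IsWealth (M : Market Ω P n d d') (x : ℝ) (π : ℝ≥0 → Ω → EuclideanSpace ℝ (Fin n))
    (X : ℝ≥0 → Ω → ℝ) : Prop :=
  StronglyAdapted M.filtration X ∧ (∀ᵐ ω ∂P, Continuous fun t => X t ω) ∧
    ∃ I : ℝ≥0 → Ω → ℝ,
      IsItoIntegral P M.filtration M.W (fun t ω => X t ω • M.exposure π t ω) I ∧
      ∀ᵐ ω ∂P, ∀ t : ℝ≥0,
        IntervalIntegrable (fun s : ℝ => X s.toNNReal ω *
          inner ℝ (M.exposure π s.toNNReal ω) (M.sharpe s.toNNReal ω)) volume 0 t ∧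
        X t ω = x + (∫ s in (0 : ℝ)..t, X s.toNNReal ω *
          inner ℝ (M.exposure π s.toNNReal ω) (M.sharpe s.toNNReal ω)) + I t ω

/-- The requirements of `T`-admissibility of a portfolio `π` with wealth process `X`. -/
def AdmissibleUpTo (M : Market Ω P n d d') (T : ℝ≥0)
    (π : ℝ≥0 → Ω → EuclideanSpace ℝ (Fin n)) (X : ℝ≥0 → Ω → ℝ) : Prop :=
  ∀ᵐ ω ∂P, ∀ t ≤ T, 0 ≤ X t ω ∧
    ∫⁻ s in Icc (0 : ℝ) t,
      ‖X s.toNNReal ω * inner ℝ (π s.toNNReal ω) (M.μ s.toNNReal ω)‖ₑ < ∞ ∧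
    ∫⁻ s in Icc (0 : ℝ) t, ‖X s.toNNReal ω • M.exposure π s.toNNReal ω‖ₑ ^ 2 < ∞

/-- `π` is a forward admissible portfolio (progressively measurable, and `T`-admissible for
every `T > 0`), and `X` is its wealth process from initial wealth `x`. -/
structure IsAdmissible (M : Market Ω P n d d') (x : ℝ)
    (π : ℝ≥0 → Ω → EuclideanSpace ℝ (Fin n)) (X : ℝ≥0 → Ω → ℝ) : Prop where
  progressive : IsStronglyProgressive M.filtration π
  wealth : M.IsWealth x π X
  admissible : ∀ T : ℝ≥0, 0 < T → M.AdmissibleUpTo T π X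

/-- A random field `U` of utilities, `U t ω x` being the utility of wealth `x` at time `t`, is
progressively measurable (jointly in the wealth variable `x ∈ (0, ∞)`). -/
def IsProgressiveField (M : Market Ω P n d d') (U : ℝ≥0 → Ω → ℝ → ℝ) : Prop :=
  ∀ t : ℝ≥0, Measurable[(Subtype.instMeasurableSpace.prod (M.filtration t)).prod
      Subtype.instMeasurableSpace]
    fun z : (Iic t × Ω) × Ioi (0 : ℝ) => U z.1.1 z.1.2 z.2

/-- `U` is a forward performance process. Utilities live on `(0, ∞)`; should an admissible wealth
process reach zero, `U t ω 0` is used, which has to be the limit of `U t ω` at zero from the right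
(for the power mixtures with positive exponents it is). -/
structure IsFPP (M : Market Ω P n d d') (U : ℝ≥0 → Ω → ℝ → ℝ) : Prop where
  progressive : M.IsProgressiveField U
  concave_increasing : ∀ᵐ ω ∂P, ∀ t,
    StrictConcaveOn ℝ (Ioi 0) (U t ω) ∧ StrictMonoOn (U t ω) (Ioi 0)
  supermartingale : ∀ x : ℝ, 0 < x → ∀ π X, M.IsAdmissible x π X →
    Supermartingale (fun t ω => U t ω (X t ω)) M.filtration P
  optimal : ∀ x : ℝ, 0 < x → ∃ π X, M.IsAdmissible x π X ∧
    Martingale (fun t ω => U t ω (X t ω)) M.filtration P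

end Market

/-- The two-power mixture `U_t(x) = A_t x^{p_t} + D_t x^{q_t}`. -/
noncomputable def twoPowerMixture {Ω : Type*} (A D p q : ℝ≥0 → Ω → ℝ) :
    ℝ≥0 → Ω → ℝ → ℝ :=
  fun t ω x => A t ω * x ^ p t ω + D t ω * x ^ q t ω

/-- An adapted process with almost surely continuous paths. -/
def IsContinuousAdapted {Ω : Type*} {mΩ : MeasurableSpace Ω} (P : Measure Ω)
    (F : Filtration ℝ≥0 mΩ) (Y : ℝ≥0 → Ω → ℝ) : Prop :=
  StronglyAdapted F Y ∧ ∀ᵐ ω ∂P, Continuous fun t => Y t ω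

/-- `Y` is integrable at all times `t ≤ T`, with `sup_{t ≤ T} E[Y_t] < ∞`, for every `T > 0`. -/
def HasBoundedMeans {Ω : Type*} [MeasurableSpace Ω] (P : Measure Ω) (Y : ℝ≥0 → Ω → ℝ) : Prop :=
  ∀ T : ℝ≥0, 0 < T → ∃ C : ℝ, ∀ t ≤ T, Integrable (Y t) P ∧ ∫ ω, Y t ω ∂P ≤ C

end ForwardPerformance

/-! Holding no stocks keeps the wealth at any constant `x > 0`, so `U_t(x)` is a supermartingale for
each fixed `x`. Hence for `s < t` and `C` in the information at time `s`, the mean of `U_t(x)` over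
`C` is at most that of `U_s(x)`, for all `x` at once.

The exponents are read off from the growth in `x`. For large `x` the larger exponent dominates:
`U_t(x) ≥ D_t x^{q_t}`, while `U_s(x)` is at most a finite random multiple of `x^{q_s}`. If `q_t >
q_s` had positive probability, the left mean would outgrow the right one on a suitable `C`. Letting
`x` tend to zero isolates `p` in the same way. Both cases are instances of
`ae_le_of_setIntegral_le_of_rpow_bounds`; continuity of paths then removes the dependence of the
null sets on `s` and `t` (`ae_monotone_of_continuous`). -/

namespace ForwardPerformance

/-! ### Comparison of random growth exponents -/

/-- If the integrals of `Z u` over `m`-measurable events are dominated by those of `Y u` for all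
`u ≥ 1`, where `Z u` grows at least like `u ^ b` and `Y u` at most like `u ^ a`, then `b ≤ a`. -/
theorem ae_le_of_setIntegral_le_of_rpow_bounds {Ω : Type*} {m m0 : MeasurableSpace Ω}
    {P : Measure Ω} [IsFiniteMeasure P] (hm : m ≤ m0) {Y Z : ℝ → Ω → ℝ} {a b K D : Ω → ℝ}
    (ha : Measurable[m] a) (hK : Measurable[m] K) (hb : Measurable b) (hD : Measurable D)
    (hDpos : ∀ᵐ ω ∂P, 0 < D ω)
    (hYi : ∀ u, 1 ≤ u → Integrable (Y u) P) (hZi : ∀ u, 1 ≤ u → Integrable (Z u) P)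
    (hY : ∀ u, 1 ≤ u → ∀ᵐ ω ∂P, Y u ω ≤ K ω * u ^ a ω)
    (hZ : ∀ u, 1 ≤ u → ∀ᵐ ω ∂P, D ω * u ^ b ω ≤ Z u ω)
    (h : ∀ u, 1 ≤ u → ∀ C, MeasurableSet[m] C → ∫ ω in C, Z u ω ∂P ≤ ∫ ω in C, Y u ω ∂P) :
    ∀ᵐ ω ∂P, b ω ≤ a ω := by
  -- Countably many such events cover `{a < b}` up to a null set. Each is split in two: the
  -- conditions on `a` and `K` are `m`-measurable, so they may serve as the test event in `h`; those
  -- on `b` and `D` need not be, and enter only through the lower bound.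
  have key : ∀ (r r' : ℚ) (N : ℕ), r < r' →
      P ({ω | (r' : ℝ) ≤ b ω ∧ 1 / ((N : ℝ) + 1) ≤ D ω} ∩ {ω | a ω ≤ r ∧ K ω ≤ N}) = 0 := by
    intro r r' N hr
    set B := {ω | (r' : ℝ) ≤ b ω ∧ 1 / ((N : ℝ) + 1) ≤ D ω} with hBdef
    set C := {ω | a ω ≤ r ∧ K ω ≤ N} with hCdef
    have hCm : MeasurableSet[m] C :=
      (measurableSet_le ha measurable_const).inter (measurableSet_le hK measurable_const)
    have hC : MeasurableSet C := hm _ hCm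
    have hB : MeasurableSet B :=
      (measurableSet_le measurable_const hb).inter (measurableSet_le measurable_const hD)
    have hN : (0 : ℝ) < 1 / ((N : ℝ) + 1) := by positivity
    have bound : ∀ u : ℝ, 1 ≤ u →
        P.real (B ∩ C) * (1 / ((N : ℝ) + 1)) * u ^ ((r' : ℝ) - r) ≤ N * P.real C := by
      intro u hu
      have hu0 : 0 < u := by linarith
      -- Since `Z u ≥ D * u ^ b ≥ 0` almost surely, the part of `C` outside `B` can be discarded.
      have lower : P.real (B ∩ C) * (1 / ((N : ℝ) + 1) * u ^ (r' : ℝ)) ≤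
          ∫ ω in C, Z u ω ∂P := by
        calc P.real (B ∩ C) * (1 / ((N : ℝ) + 1) * u ^ (r' : ℝ))
            = ∫ ω in C, B.indicator (fun _ => 1 / ((N : ℝ) + 1) * u ^ (r' : ℝ)) ω ∂P := by
              rw [integral_indicator hB, Measure.restrict_restrict hB, setIntegral_const,
                smul_eq_mul]
          _ ≤ ∫ ω in C, Z u ω ∂P := by
              refine setIntegral_mono_ae ((integrable_const _).indicator hB).integrableOn
                (hZi u hu).integrableOn ?_
              filter_upwards [hZ u hu, hDpos] with ω h1 h2
              refine le_trans ?_ h1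
              by_cases hω : ω ∈ B
              · rw [indicator_of_mem hω]
                exact mul_le_mul hω.2 (Real.rpow_le_rpow_of_exponent_le hu hω.1) (by positivity)
                  h2.le
              · rw [indicator_of_notMem hω]
                positivity
      have upper : ∫ ω in C, Y u ω ∂P ≤ P.real C * (N * u ^ (r : ℝ)) := by
        calc ∫ ω in C, Y u ω ∂P ≤ ∫ _ in C, (N : ℝ) * u ^ (r : ℝ) ∂P := by
              refine setIntegral_mono_on_ae (hYi u hu).integrableOn
                (integrable_const _).integrableOn hC ?_
              filter_upwards [hY u hu] with ω h1 hω
              -- `K` may be negative: only `K ≤ N`, `0 ≤ N` and `0 ≤ u ^ a` matter.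
              exact h1.trans (mul_le_mul hω.2 (Real.rpow_le_rpow_of_exponent_le hu hω.1)
                (by positivity) (by positivity))
          _ = P.real C * (N * u ^ (r : ℝ)) := by rw [setIntegral_const, smul_eq_mul]
      have hle := lower.trans ((h u hu C hCm).trans upper)
      have hpos : 0 < u ^ (r : ℝ) := by positivity
      refine le_of_mul_le_mul_right ?_ hpos
      calc P.real (B ∩ C) * (1 / ((N : ℝ) + 1)) * u ^ ((r' : ℝ) - r) * u ^ (r : ℝ)
          = P.real (B ∩ C) * (1 / ((N : ℝ) + 1)) * u ^ (r' : ℝ) := by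
            rw [mul_assoc _ (u ^ ((r' : ℝ) - r)), ← Real.rpow_add hu0, sub_add_cancel]
        _ ≤ N * P.real C * u ^ (r : ℝ) := by linarith
    -- A positive mass of `B ∩ C` would make the left side of `bound` unbounded in `u`.
    by_contra hne
    have hP : 0 < P.real (B ∩ C) :=
      ENNReal.toReal_pos hne (measure_ne_top _ _)
    have hexp : (0 : ℝ) < (r' : ℝ) - r := sub_pos.2 (by exact_mod_cast hr)
    have hlim : Tendsto (fun u : ℝ => P.real (B ∩ C) * (1 / ((N : ℝ) + 1)) *
        u ^ ((r' : ℝ) - r)) atTop atTop :=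
      (tendsto_rpow_atTop hexp).const_mul_atTop (mul_pos hP hN)
    obtain ⟨u, hu, hu1⟩ :=
      ((hlim.eventually_gt_atTop (N * P.real C)).and (eventually_ge_atTop 1)).exists
    exact (bound u hu1).not_gt hu
  have hall : ∀ᵐ ω ∂P, ∀ (r r' : ℚ) (N : ℕ), r < r' →
      ω ∉ {ω | (r' : ℝ) ≤ b ω ∧ 1 / ((N : ℝ) + 1) ≤ D ω} ∩ {ω | a ω ≤ r ∧ K ω ≤ N} := by
    simp only [ae_all_iff]
    intro r r' N hr
    exact measure_eq_zero_iff_ae_notMem.1 (key r r' N hr)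
  filter_upwards [hall, hDpos] with ω hω hDω
  by_contra! hlt
  obtain ⟨r, hr1, hr2⟩ := exists_rat_btwn hlt
  obtain ⟨r', hr1', hr2'⟩ := exists_rat_btwn hr2
  obtain ⟨N₁, hN₁⟩ := exists_nat_one_div_lt hDω
  obtain ⟨N₂, hN₂⟩ := exists_nat_ge (K ω)
  -- One integer has two tasks: `1 / (N + 1)` lies below `D`, and `N` above `K`.
  refine hω r r' (max N₁ N₂) (by exact_mod_cast hr1') ⟨⟨hr2'.le, ?_⟩, hr1.le, ?_⟩
  · refine le_trans ?_ hN₁.le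
    exact Nat.one_div_le_one_div (le_max_left _ _)
  · exact hN₂.trans (by exact_mod_cast le_max_right _ _)

/-! ### From pairs of times to paths -/

/-- Almost sure monotonicity over each pair of times gives almost surely monotone paths, for a
process with continuous paths. -/
theorem ae_monotone_of_continuous {Ω : Type*} {m0 : MeasurableSpace Ω} {P : Measure Ω}
    {f : ℝ≥0 → Ω → ℝ} (hf : ∀ᵐ ω ∂P, Continuous fun t => f t ω)
    (h : ∀ s t, s < t → ∀ᵐ ω ∂P, f s ω ≤ f t ω) : ∀ᵐ ω ∂P, Monotone fun t => f t ω := by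
  obtain ⟨S, hSc, hSd⟩ := TopologicalSpace.exists_countable_dense ℝ≥0
  have hall : ∀ᵐ ω ∂P, ∀ s ∈ S, ∀ t ∈ S, s < t → f s ω ≤ f t ω := by
    rw [ae_ball_iff hSc]
    intro s _
    rw [ae_ball_iff hSc]
    intro t _
    rw [ae_all_iff]
    exact h s t
  filter_upwards [hf, hall] with ω hc hω
  refine monotone_iff_forall_lt.2 fun s t hst => ?_
  by_contra! hlt
  obtain ⟨c, hc1, hc2⟩ := exists_between hlt
  obtain ⟨v, hv1, hv2⟩ := exists_between hst
  -- A strict decrease from `s` to `t` persists nearby, so it is seen at times of the dense set;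
  -- separating them by `v` guarantees `s' < t'`.
  obtain ⟨s', ⟨hs1, hs2⟩, hs⟩ := hSd.inter_open_nonempty (Iio v ∩ {x | c < f x ω})
    (isOpen_Iio.inter (isOpen_lt continuous_const hc)) ⟨s, hv1, hc2⟩
  obtain ⟨t', ⟨ht1, ht2⟩, ht⟩ := hSd.inter_open_nonempty (Ioi v ∩ {x | f x ω < c})
    (isOpen_Ioi.inter (isOpen_lt hc continuous_const)) ⟨t, hv2, hc1⟩
  exact (hω s' hs t' ht (lt_trans hs1 ht1)).not_gt (lt_trans ht2 hs2)

/-! ### The zero portfolio -/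

/-- The zero integrand has Itô integral zero. -/
theorem isItoIntegral_zero {Ω : Type*} {mΩ : MeasurableSpace Ω} (P : Measure Ω)
    (F : Filtration ℝ≥0 mΩ) {d : ℕ} (W : ℝ≥0 → Ω → EuclideanSpace ℝ (Fin d)) :
    IsItoIntegral P F W (fun _ _ => 0) (fun _ _ => 0) := by
  -- The approximating integrands are empty sums, so both error events reduce to `ε ≤ 0`.
  refine ⟨fun t => stronglyMeasurable_const, ae_of_all _ fun _ => continuous_const,
    fun _ => ⟨0, fun _ => 0, monotone_const, fun _ _ => 0, fun _ => stronglyMeasurable_const,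
      0, by simp⟩, fun T ε hε => ?_⟩
  simp [SimpleIntegrand.process, SimpleIntegrand.integral, hε.ne']

namespace Market

variable {Ω : Type*} [mΩ : MeasurableSpace Ω] {P : Measure Ω} {n d d' : ℕ}

theorem exposure_zero (M : Market Ω P n d d') (t : ℝ≥0) (ω : Ω) :
    M.exposure (fun _ _ => 0) t ω = 0 := by
  simp [exposure]

/-- Holding no stocks is admissible and keeps the wealth constant. -/
theorem isAdmissible_zero (M : Market Ω P n d d') {x : ℝ} (hx : 0 ≤ x) :
    M.IsAdmissible x (fun _ _ => 0) (fun _ _ => x) where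
  progressive := fun _ => stronglyMeasurable_const
  wealth := by
    refine ⟨fun _ => stronglyMeasurable_const, ae_of_all _ fun _ => continuous_const,
      fun _ _ => 0, ?_, ?_⟩
    · simpa only [exposure_zero, smul_zero] using isItoIntegral_zero P M.filtration M.W
    · simp [exposure_zero]
  admissible := by
    intro T _
    simp [exposure_zero, hx, AdmissibleUpTo]

/-- The utility of a constant wealth is a supermartingale. -/
theorem IsFPP.supermartingale_const {M : Market Ω P n d d'} {U : ℝ≥0 → Ω → ℝ → ℝ}
    (hU : M.IsFPP U) {x : ℝ} (hx : 0 < x) :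
    Supermartingale (fun t ω => U t ω x) M.filtration P :=
  hU.supermartingale x hx _ _ (M.isAdmissible_zero hx.le)

/-! ### Monotonicity of the two exponents -/

section TwoPowerMixture

variable [IsFiniteMeasure P] {M : Market Ω P n d d'} {A D p q : ℝ≥0 → Ω → ℝ}

/-- The larger exponent decreases: compare the utilities of large wealths. -/
theorem ae_larger_exponent_le (hA : StronglyAdapted M.filtration A)
    (hD : StronglyAdapted M.filtration D) (hq : StronglyAdapted M.filtration q)
    (hpq : ∀ᵐ ω ∂P, ∀ t, p t ω < q t ω)
    (hpos : ∀ t, 0 < t → ∀ᵐ ω ∂P, 0 < A t ω ∧ 0 < D t ω)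
    (hU : M.IsFPP (twoPowerMixture A D p q)) {s t : ℝ≥0} (hst : s < t) :
    ∀ᵐ ω ∂P, q t ω ≤ q s ω := by
  have ht : 0 < t := pos_of_gt hst
  have hsup : ∀ u : ℝ, 1 ≤ u →
      Supermartingale (fun t ω => twoPowerMixture A D p q t ω u) M.filtration P :=
    fun u hu => hU.supermartingale_const (by linarith)
  -- The absolute values in `K` cover `s = 0`, where positivity of `A` and `D` is not assumed. The
  -- lower bound concerns time `t > 0` only.
  refine ae_le_of_setIntegral_le_of_rpow_bounds (M.filtration.le s)
    (Y := fun u ω => twoPowerMixture A D p q s ω u)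
    (Z := fun u ω => twoPowerMixture A D p q t ω u)
    (K := fun ω => |A s ω| + |D s ω|) (D := D t)
    (hq s).measurable ((hA s).norm.measurable.add (hD s).norm.measurable)
    ((hq t).mono (M.filtration.le t)).measurable ((hD t).mono (M.filtration.le t)).measurable
    ((hpos t ht).mono fun _ h => h.2) (fun u hu => (hsup u hu).integrable s)
    (fun u hu => (hsup u hu).integrable t) ?_ ?_
    (fun u hu C hC => (hsup u hu).setIntegral_le hst.le hC)
  · intro u hu
    filter_upwards [hpq] with ω h
    have h1 : u ^ p s ω ≤ u ^ q s ω := Real.rpow_le_rpow_of_exponent_le hu (h s).le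
    have h2 : 0 ≤ u ^ p s ω := Real.rpow_nonneg (by linarith) _
    have h3 : 0 ≤ u ^ q s ω := h2.trans h1
    rw [twoPowerMixture, add_mul]
    exact add_le_add (mul_le_mul (le_abs_self _) h1 h2 (abs_nonneg _))
      (mul_le_mul_of_nonneg_right (le_abs_self _) h3)
  · intro u hu
    filter_upwards [hpos t ht] with ω h
    have : 0 ≤ A t ω * u ^ p t ω := mul_nonneg h.1.le (Real.rpow_nonneg (by linarith) _)
    simpa [twoPowerMixture] using this

/-- The smaller exponent increases: compare the utilities of small wealths. -/
theorem ae_le_smaller_exponent (hA : StronglyAdapted M.filtration A)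
    (hD : StronglyAdapted M.filtration D) (hp : StronglyAdapted M.filtration p)
    (hpq : ∀ᵐ ω ∂P, ∀ t, p t ω < q t ω)
    (hpos : ∀ t, 0 < t → ∀ᵐ ω ∂P, 0 < A t ω ∧ 0 < D t ω)
    (hU : M.IsFPP (twoPowerMixture A D p q)) {s t : ℝ≥0} (hst : s < t) :
    ∀ᵐ ω ∂P, p s ω ≤ p t ω := by
  have ht : 0 < t := pos_of_gt hst
  -- At wealth `u⁻¹` the mixture has exponents `-q < -p` in `u`, so the comparison for large `u` now
  -- selects `-p`.
  have hsup : ∀ u : ℝ, 1 ≤ u →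
      Supermartingale (fun t ω => twoPowerMixture A D p q t ω u⁻¹) M.filtration P :=
    fun u hu => hU.supermartingale_const (inv_pos.2 (by linarith))
  have hmain : ∀ᵐ ω ∂P, -p t ω ≤ -p s ω := by
    refine ae_le_of_setIntegral_le_of_rpow_bounds (M.filtration.le s)
      (Y := fun u ω => twoPowerMixture A D p q s ω u⁻¹)
      (Z := fun u ω => twoPowerMixture A D p q t ω u⁻¹)
      (K := fun ω => |A s ω| + |D s ω|) (D := A t)
      (hp s).measurable.neg ((hA s).norm.measurable.add (hD s).norm.measurable)
      ((hp t).mono (M.filtration.le t)).measurable.neg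
      ((hA t).mono (M.filtration.le t)).measurable
      ((hpos t ht).mono fun _ h => h.1) (fun u hu => (hsup u hu).integrable s)
      (fun u hu => (hsup u hu).integrable t) ?_ ?_
      (fun u hu C hC => (hsup u hu).setIntegral_le hst.le hC)
    · intro u hu
      have hu0 : 0 ≤ u := by linarith
      filter_upwards [hpq] with ω h
      have h1 : u ^ (-q s ω) ≤ u ^ (-p s ω) :=
        Real.rpow_le_rpow_of_exponent_le hu (neg_le_neg (h s).le)
      have h2 : 0 ≤ u ^ (-q s ω) := Real.rpow_nonneg hu0 _
      have h3 : 0 ≤ u ^ (-p s ω) := h2.trans h1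
      rw [twoPowerMixture, add_mul, Real.inv_rpow hu0, Real.inv_rpow hu0, ← Real.rpow_neg hu0,
        ← Real.rpow_neg hu0]
      exact add_le_add (mul_le_mul_of_nonneg_right (le_abs_self _) h3)
        (mul_le_mul (le_abs_self _) h1 h2 (abs_nonneg _))
    · intro u hu
      have hu0 : 0 ≤ u := by linarith
      filter_upwards [hpos t ht] with ω h
      have : 0 ≤ D t ω * u⁻¹ ^ q t ω := mul_nonneg h.2.le (Real.rpow_nonneg (by positivity) _)
      rw [Real.rpow_neg hu0, ← Real.inv_rpow hu0]
      simpa [twoPowerMixture] using this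
  filter_upwards [hmain] with ω h
  exact neg_le_neg_iff.1 h

end TwoPowerMixture

end Market

end ForwardPerformance

open ForwardPerformance in
theorem lemma4p2 {Ω : Type*} [MeasurableSpace Ω] (P : Measure Ω) [IsProbabilityMeasure P]
    {n d d' : ℕ} (hn : 1 ≤ n) (hd : 1 ≤ d) (M : Market Ω P n d d')
    (A D p q : ℝ≥0 → Ω → ℝ)
    (hA : IsContinuousAdapted P M.filtration A) (hD : IsContinuousAdapted P M.filtration D)
    (hp : IsContinuousAdapted P M.filtration p) (hq : IsContinuousAdapted P M.filtration q)
    (hpq : ∀ᵐ ω ∂P, ∀ t, 0 < p t ω ∧ p t ω < q t ω ∧ q t ω < 1)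
    (hpos : ∀ t, 0 < t → ∀ᵐ ω ∂P, 0 < A t ω ∧ 0 < D t ω)
    (hA_mean : HasBoundedMeans P A) (hD_mean : HasBoundedMeans P D)
    (hU : M.IsFPP (twoPowerMixture A D p q)) :
    ∀ᵐ ω ∂P, (Monotone fun t => p t ω) ∧ (Antitone fun t => q t ω) ∧
      ∀ s t : ℝ≥0, 0 < s → s < t →
        p 0 ω ≤ p s ω ∧ p s ω ≤ p t ω ∧ p t ω < q t ω ∧ q t ω ≤ q s ω ∧ q s ω ≤ q 0 ω := by
  have hlt : ∀ᵐ ω ∂P, ∀ t, p t ω < q t ω := hpq.mono fun ω h t => (h t).2.1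
  have hmono : ∀ᵐ ω ∂P, Monotone fun t => p t ω :=
    ae_monotone_of_continuous hp.2 fun s t hst =>
      Market.ae_le_smaller_exponent hA.1 hD.1 hp.1 hlt hpos hU hst
  have hanti : ∀ᵐ ω ∂P, Monotone fun t => -q t ω :=
    ae_monotone_of_continuous (f := fun t ω => -q t ω) (hq.2.mono fun ω h => h.neg)
      fun s t hst => (Market.ae_larger_exponent_le hA.1 hD.1 hq.1 hlt hpos hU hst).mono
        fun ω h => neg_le_neg h
  filter_upwards [hmono, hanti, hlt] with ω h1 h2 h3
  have h2' : Antitone fun t => q t ω := fun s t hst => neg_le_neg_iff.1 (h2 hst)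
  exact ⟨h1, h2', fun s t hs hst =>
    ⟨h1 hs.le, h1 hst.le, h3 t, h2' hst.le, h2' hs.le⟩⟩
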